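/- Let $G$ be a locally compact Hausdorff group with left Haar measure $dx$, let $1<p<\infty$ and $\frac1p+\frac1q=1$. Let $A_p(G)$ be the Herz algebra, that is, the space of all functions $u=\sum_{i=1}^{\infty} g_i*f_i^{\vee}$ on $G$ with $f_i\in L^p(G)$, $g_i\in L^q(G)$ and $\sum_{i}\|f_i\|_p\|g_i\|_q<\infty$, where $f^{\vee}(x)=f(x^{-1})$, normed by the infimum of $\sum_i\|f_i\|_p\|g_i\|_q$ over all such representations of $u$. Let $B_p(G)$ be the space of all bounded continuous functions $u:G\to\mathbb{C}$ such that $uv\in A_p(G)$ for every $v\in A_p(G)$, with the norm $\|u\|=\sup\{\|uv\|_{A_p(G)} : v\in A_p(G),\ \|v\|_{A_p(G)}\le 1\}$. If the Banach space dual $B_p(G)^*$ is separable in its norm topology, then $G$ is discrete. -/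

import Mathlib

open MeasureTheory Filter Topology
open scoped ENNReal BoundedContinuousFunction

noncomputable section

namespace Herz

variable {G : Type*} [Group G] [MeasurableSpace G]

/-- Convolution `(g * h)(x) = ∫ g(y) h(y⁻¹x) dy` of complex functions on a group. -/
def convolve (μ : Measure G) (g h : G → ℂ) (x : G) : ℂ :=
  ∫ y, g y * h (y⁻¹ * x) ∂μ

/-- `f^∨(x) = f(x⁻¹)`. -/
def check (f : G → ℂ) (x : G) : ℂ := f x⁻¹

theorem convolve_check (μ : Measure G) (g f : G → ℂ) (x : G) :
    convolve μ g (check f) x = ∫ y, g y * f (x⁻¹ * y) ∂μ := by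
  simp [convolve, check]

/-- The families `f i ∈ L^p`, `g i ∈ L^q` represent `u`: one has `∑ ‖f i‖_p ‖g i‖_q < ∞` and
`u = ∑ g i * (f i)^∨` at every point of `G`. -/
structure Represents {p q : ℝ≥0∞} {μ : Measure G} {ι : Type*}
    (f : ι → Lp ℂ p μ) (g : ι → Lp ℂ q μ) (u : G → ℂ) : Prop where
  summable : Summable fun i => ‖f i‖ * ‖g i‖
  hasSum : ∀ x, HasSum (fun i => convolve μ (g i) (check (f i)) x) (u x)

section Algebra

variable {p q : ℝ≥0∞} {μ : Measure G}

theorem convolve_zero_left (h : G → ℂ) (x : G) :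
    convolve μ ((0 : Lp ℂ q μ) : G → ℂ) h x = 0 := by
  have : (fun y => ((0 : Lp ℂ q μ) : G → ℂ) y * h (y⁻¹ * x)) =ᵐ[μ] fun _ => 0 := by
    filter_upwards [Lp.coeFn_zero ℂ q μ] with y hy
    rw [hy, Pi.zero_apply, zero_mul]
  rw [convolve, integral_congr_ae this]
  simp

theorem convolve_smul_left (c : ℂ) (g : Lp ℂ q μ) (h : G → ℂ) (x : G) :
    convolve μ ((c • g : Lp ℂ q μ) : G → ℂ) h x = c * convolve μ g h x := by
  have : (fun y => ((c • g : Lp ℂ q μ) : G → ℂ) y * h (y⁻¹ * x)) =ᵐ[μ]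
      fun y => c * (g y * h (y⁻¹ * x)) := by
    filter_upwards [Lp.coeFn_smul c g] with y hy
    simp [hy, mul_assoc]
  rw [convolve, integral_congr_ae this, integral_const_mul, convolve]

theorem lp_norm_nonneg {X : Type*} [MeasurableSpace X] {r : ℝ≥0∞} {ν : Measure X}
    (f : Lp ℂ r ν) : 0 ≤ ‖f‖ := by
  rw [Lp.norm_def]; exact ENNReal.toReal_nonneg

/-- A representation over a countable index type can be reindexed over `ℕ`. -/
theorem Represents.exists_nat {ι : Type*} [Countable ι] {f : ι → Lp ℂ p μ} {g : ι → Lp ℂ q μ}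
    {u : G → ℂ} (h : Represents f g u) :
    ∃ (f' : ℕ → Lp ℂ p μ) (g' : ℕ → Lp ℂ q μ), Represents f' g' u ∧
      ∑' i, ‖f' i‖ * ‖g' i‖ = ∑' i, ‖f i‖ * ‖g i‖ := by
  obtain ⟨e, he⟩ := Countable.exists_injective_nat ι
  have h1 : (fun n => ‖Function.extend e f 0 n‖ * ‖Function.extend e g 0 n‖) =
      Function.extend e (fun i => ‖f i‖ * ‖g i‖) 0 := by
    funext n
    by_cases hn : ∃ i, e i = n
    · obtain ⟨i, rfl⟩ := hn
      simp [he.extend_apply]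
    · simp [Function.extend_apply' _ _ _ hn]
  have h2 : ∀ x, (fun n => convolve μ ((Function.extend e g 0 n : Lp ℂ q μ) : G → ℂ)
      (check ((Function.extend e f 0 n : Lp ℂ p μ) : G → ℂ)) x) =
      Function.extend e (fun i => convolve μ (g i) (check (f i)) x) 0 := by
    intro x
    funext n
    by_cases hn : ∃ i, e i = n
    · obtain ⟨i, rfl⟩ := hn
      simp [he.extend_apply]
    · simp only [Function.extend_apply' _ _ _ hn, Pi.zero_apply]
      exact convolve_zero_left _ _
  refine ⟨Function.extend e f 0, Function.extend e g 0, ⟨?_, fun x => ?_⟩, ?_⟩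
  · rw [h1]; exact (summable_extend_zero he).2 h.summable
  · rw [h2]; exact (hasSum_extend_zero he).2 (h.hasSum x)
  · rw [h1]; exact tsum_extend_zero he _

theorem Represents.smul {ι : Type*} {f : ι → Lp ℂ p μ} {g : ι → Lp ℂ q μ}
    {u : G → ℂ} (h : Represents f g u) (c : ℂ) :
    Represents f (fun i => c • g i) (c • u) ∧
      ∑' i, ‖f i‖ * ‖c • g i‖ = ‖c‖ * ∑' i, ‖f i‖ * ‖g i‖ := by
  have h1 : (fun i => ‖f i‖ * ‖c • g i‖) = fun i => ‖c‖ * (‖f i‖ * ‖g i‖) := by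
    funext i
    have : ‖c • g i‖ = ‖c‖ * ‖g i‖ := by
      rw [Lp.norm_def, Lp.norm_def, eLpNorm_congr_ae (Lp.coeFn_smul c (g i)),
        eLpNorm_const_smul]
      simp
    rw [this]; ring
  refine ⟨⟨?_, fun x => ?_⟩, ?_⟩
  · rw [h1]; exact h.summable.mul_left _
  · simp only [convolve_smul_left, Pi.smul_apply, smul_eq_mul]
    exact (h.hasSum x).mul_left c
  · rw [h1, tsum_mul_left]

theorem Represents.add {f₁ f₂ : ℕ → Lp ℂ p μ} {g₁ g₂ : ℕ → Lp ℂ q μ}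
    {u₁ u₂ : G → ℂ} (h₁ : Represents f₁ g₁ u₁) (h₂ : Represents f₂ g₂ u₂) :
    Represents (Sum.elim f₁ f₂) (Sum.elim g₁ g₂) (u₁ + u₂) ∧
      ∑' i, ‖Sum.elim f₁ f₂ i‖ * ‖Sum.elim g₁ g₂ i‖ =
        ∑' i, ‖f₁ i‖ * ‖g₁ i‖ + ∑' i, ‖f₂ i‖ * ‖g₂ i‖ := by
  have h : HasSum (fun i => ‖Sum.elim f₁ f₂ i‖ * ‖Sum.elim g₁ g₂ i‖)
      (∑' i, ‖f₁ i‖ * ‖g₁ i‖ + ∑' i, ‖f₂ i‖ * ‖g₂ i‖) :=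
    HasSum.sum (by simpa [Function.comp_def] using h₁.summable.hasSum)
      (by simpa [Function.comp_def] using h₂.summable.hasSum)
  refine ⟨⟨h.summable, fun x => ?_⟩, h.tsum_eq⟩
  exact HasSum.sum (by simpa [Function.comp_def] using h₁.hasSum x)
      (by simpa [Function.comp_def] using h₂.hasSum x)

variable (p q μ) in
/-- The functions `u = ∑ g i * (f i)^∨` with `f i ∈ L^p`, `g i ∈ L^q`, `∑ ‖f i‖_p ‖g i‖_q < ∞`.
For conjugate `1 < p, q < ∞` and a Haar measure they are automatically in `C_0(G)`. -/
def herzSubmodule : Submodule ℂ (G → ℂ) where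
  carrier := {u | ∃ (f : ℕ → Lp ℂ p μ) (g : ℕ → Lp ℂ q μ), Represents f g u}
  add_mem' := by
    rintro u v ⟨f₁, g₁, h₁⟩ ⟨f₂, g₂, h₂⟩
    obtain ⟨f, g, h, -⟩ := (h₁.add h₂).1.exists_nat
    exact ⟨f, g, h⟩
  zero_mem' := by
    refine ⟨0, 0, ⟨?_, fun x => ?_⟩⟩
    · simp
    · simp only [Pi.zero_apply, convolve_zero_left]
      exact hasSum_zero
  smul_mem' := by
    rintro c u ⟨f, g, h⟩
    exact ⟨f, _, (h.smul c).1⟩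

end Algebra

/-- The Herz algebra `A_p(G)`; here `q` is the exponent conjugate to `p`. A separate type, so that
it carries its own norm and not the topology of pointwise convergence. -/
def HerzAlgebra (p q : ℝ≥0∞) (μ : Measure G) : Type _ := ↥(herzSubmodule p q μ)

namespace HerzAlgebra

variable {p q : ℝ≥0∞} {μ : Measure G}

instance : AddCommGroup (HerzAlgebra p q μ) :=
  inferInstanceAs (AddCommGroup ↥(herzSubmodule p q μ))

instance : Module ℂ (HerzAlgebra p q μ) :=
  inferInstanceAs (Module ℂ ↥(herzSubmodule p q μ))

/-- The function underlying an element of `A_p(G)`. -/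
def toFun (u : HerzAlgebra p q μ) : G → ℂ := Subtype.val u

theorem toFun_injective : Function.Injective (toFun : HerzAlgebra p q μ → G → ℂ) :=
  Subtype.val_injective

@[simp] theorem toFun_add (u v : HerzAlgebra p q μ) : (u + v).toFun = u.toFun + v.toFun := rfl

@[simp] theorem toFun_smul (c : ℂ) (v : HerzAlgebra p q μ) : (c • v).toFun = c • v.toFun := rfl

@[simp] theorem toFun_zero : (0 : HerzAlgebra p q μ).toFun = 0 := rfl

@[simp] theorem toFun_sub (u v : HerzAlgebra p q μ) : (u - v).toFun = u.toFun - v.toFun := rfl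

theorem toFun_sum {ι : Type*} (s : Finset ι) (u : ι → HerzAlgebra p q μ) :
    (∑ i ∈ s, u i).toFun = ∑ i ∈ s, (u i).toFun := by
  classical
  induction s using Finset.induction_on with
  | empty => simp
  | insert a s ha ih => simp [Finset.sum_insert ha, ih]

/-- The values `∑ ‖f i‖_p ‖g i‖_q` over all representations `u = ∑ g i * (f i)^∨`. -/
def costs (u : HerzAlgebra p q μ) : Set ℝ :=
  {r | ∃ (f : ℕ → Lp ℂ p μ) (g : ℕ → Lp ℂ q μ), Represents f g u.toFun ∧
    r = ∑' i, ‖f i‖ * ‖g i‖}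

/-- The norm of `A_p(G)`: the infimum of `∑ ‖f i‖_p ‖g i‖_q` over all representations. -/
instance : Norm (HerzAlgebra p q μ) := ⟨fun u => sInf (costs u)⟩

theorem norm_def (u : HerzAlgebra p q μ) : ‖u‖ = sInf (costs u) := rfl

theorem costs_nonempty (u : HerzAlgebra p q μ) : (costs u).Nonempty := by
  obtain ⟨f, g, h⟩ := u.2
  exact ⟨_, f, g, h, rfl⟩

theorem nonneg_of_mem_costs {u : HerzAlgebra p q μ} {r : ℝ} (hr : r ∈ costs u) : 0 ≤ r := by
  obtain ⟨f, g, -, rfl⟩ := hr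
  exact tsum_nonneg fun i => mul_nonneg (lp_norm_nonneg _) (lp_norm_nonneg _)

theorem costs_bddBelow (u : HerzAlgebra p q μ) : BddBelow (costs u) :=
  ⟨0, fun _ hr => nonneg_of_mem_costs hr⟩

theorem norm_nonneg' (u : HerzAlgebra p q μ) : 0 ≤ ‖u‖ :=
  le_csInf (costs_nonempty u) fun _ hr => nonneg_of_mem_costs hr

theorem norm_le_of_represents {ι : Type*} [Countable ι] {u : HerzAlgebra p q μ}
    {f : ι → Lp ℂ p μ} {g : ι → Lp ℂ q μ} (h : Represents f g u.toFun) :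
    ‖u‖ ≤ ∑' i, ‖f i‖ * ‖g i‖ := by
  obtain ⟨f', g', h', he⟩ := h.exists_nat
  rw [← he]
  exact csInf_le (costs_bddBelow u) ⟨f', g', h', rfl⟩

theorem exists_represents (u : HerzAlgebra p q μ) {ε : ℝ} (hε : 0 < ε) :
    ∃ (f : ℕ → Lp ℂ p μ) (g : ℕ → Lp ℂ q μ), Represents f g u.toFun ∧
      ∑' i, ‖f i‖ * ‖g i‖ < ‖u‖ + ε := by
  obtain ⟨r, ⟨f, g, h, rfl⟩, hr⟩ :=
    exists_lt_of_csInf_lt (costs_nonempty u) (lt_add_of_pos_right (sInf (costs u)) hε)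
  exact ⟨f, g, h, hr⟩

theorem norm_add_le' (u v : HerzAlgebra p q μ) : ‖u + v‖ ≤ ‖u‖ + ‖v‖ := by
  refine le_of_forall_pos_lt_add fun ε hε => ?_
  obtain ⟨f₁, g₁, h₁, e₁⟩ := exists_represents u (half_pos hε)
  obtain ⟨f₂, g₂, h₂, e₂⟩ := exists_represents v (half_pos hε)
  have h := h₁.add h₂
  have := norm_le_of_represents (u := u + v) h.1
  rw [h.2] at this
  linarith

theorem norm_smul_le' (c : ℂ) (u : HerzAlgebra p q μ) : ‖c • u‖ ≤ ‖c‖ * ‖u‖ := by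
  refine le_of_forall_pos_lt_add fun ε hε => ?_
  have hc : 0 < ‖c‖ + 1 := by positivity
  obtain ⟨f, g, h, e⟩ := exists_represents u (div_pos hε hc)
  have h' := h.smul c
  have := norm_le_of_represents (u := c • u) h'.1
  rw [h'.2] at this
  have h3 : ‖c‖ * ∑' i, ‖f i‖ * ‖g i‖ ≤ ‖c‖ * (‖u‖ + ε / (‖c‖ + 1)) :=
    mul_le_mul_of_nonneg_left e.le (norm_nonneg c)
  have h4 : ‖c‖ * (ε / (‖c‖ + 1)) < ε := by
    rw [← mul_div_assoc, div_lt_iff₀ hc]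
    nlinarith
  nlinarith

section Haar

variable [hpq : p.HolderConjugate q] [MeasurableMul G] [μ.IsMulLeftInvariant]

theorem norm_convolve_le (f : Lp ℂ p μ) (g : Lp ℂ q μ) (x : G) :
    ‖convolve μ g (check f) x‖ ≤ ‖f‖ * ‖g‖ := by
  rw [convolve_check]
  have hmp : MeasurePreserving (fun y => x⁻¹ * y) μ μ := measurePreserving_mul_left μ x⁻¹
  have hF : MemLp (fun y => f (x⁻¹ * y)) p μ := (Lp.memLp f).comp_measurePreserving hmp
  have hFn : eLpNorm (fun y => f (x⁻¹ * y)) p μ = eLpNorm f p μ :=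
    eLpNorm_comp_measurePreserving (Lp.memLp f).1 hmp
  have h1 : ENNReal.ofReal ‖∫ y, g y * f (x⁻¹ * y) ∂μ‖ ≤
      eLpNorm f p μ * eLpNorm g q μ := by
    calc ENNReal.ofReal ‖∫ y, g y * f (x⁻¹ * y) ∂μ‖
        ≤ ∫⁻ y, ‖g y * f (x⁻¹ * y)‖ₑ ∂μ := by
          rw [ofReal_norm]; exact enorm_integral_le_lintegral_enorm _
      _ = eLpNorm ((fun y => f (x⁻¹ * y)) • (g : G → ℂ)) 1 μ := by
          rw [eLpNorm_one_eq_lintegral_enorm]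
          refine lintegral_congr fun y => ?_
          simp [mul_comm]
      _ ≤ eLpNorm (fun y => f (x⁻¹ * y)) p μ * eLpNorm g q μ :=
          eLpNorm_smul_le_mul_eLpNorm (Lp.memLp g).1 hF.1
      _ = _ := by rw [hFn]
  rw [Lp.norm_def, Lp.norm_def, ← ENNReal.toReal_mul]
  exact (ENNReal.ofReal_le_iff_le_toReal
    (ENNReal.mul_ne_top (Lp.eLpNorm_ne_top f) (Lp.eLpNorm_ne_top g))).1 h1

theorem norm_apply_le (u : HerzAlgebra p q μ) (x : G) : ‖u.toFun x‖ ≤ ‖u‖ := by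
  refine le_of_forall_pos_le_add fun ε hε => ?_
  obtain ⟨f, g, h, e⟩ := exists_represents u hε
  rw [← (h.hasSum x).tsum_eq]
  exact (tsum_of_norm_bounded h.summable.hasSum fun i => norm_convolve_le _ _ x).trans e.le

theorem core : NormedSpace.Core ℂ (HerzAlgebra p q μ) where
  norm_nonneg := norm_nonneg'
  norm_smul c u := by
    refine le_antisymm (norm_smul_le' c u) ?_
    by_cases hc : c = 0
    · simpa [hc] using norm_nonneg' (0 : HerzAlgebra p q μ)
    · have h := norm_smul_le' c⁻¹ (c • u)
      rw [inv_smul_smul₀ hc, norm_inv] at h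
      have hc' : 0 < ‖c‖ := norm_pos_iff.2 hc
      rwa [inv_mul_eq_div, le_div_iff₀ hc', mul_comm] at h
  norm_triangle := norm_add_le'
  norm_eq_zero_iff u := by
    constructor
    · intro h
      refine toFun_injective (funext fun x => ?_)
      simpa [h] using norm_apply_le u x
    · rintro rfl
      have := norm_smul_le' 0 (0 : HerzAlgebra p q μ)
      rw [zero_smul, norm_zero, zero_mul] at this
      exact le_antisymm this (norm_nonneg' _)

instance : NormedAddCommGroup (HerzAlgebra p q μ) := NormedAddCommGroup.ofCore core

instance : NormedSpace ℂ (HerzAlgebra p q μ) := NormedSpace.ofCore core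

/-- A pointwise sum of a norm-summable sequence is in `A_p(G)`, with the expected bound. -/
theorem exists_of_summable (u : ℕ → HerzAlgebra p q μ) (hu : Summable fun n => ‖u n‖)
    (w : G → ℂ) (hw : ∀ x, HasSum (fun n => (u n).toFun x) (w x)) :
    ∃ v : HerzAlgebra p q μ, v.toFun = w ∧ ‖v‖ ≤ ∑' n, ‖u n‖ := by
  have key : ∀ ε : ℝ, 0 < ε → ∃ (f : ℕ × ℕ → Lp ℂ p μ) (g : ℕ × ℕ → Lp ℂ q μ),
      Represents f g w ∧ ∑' i, ‖f i‖ * ‖g i‖ ≤ ∑' n, ‖u n‖ + ε := by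
    intro ε hε
    obtain ⟨δ, hδ, c, hc, hcε⟩ := posSumOfEncodable hε ℕ
    choose f g h e using fun n => exists_represents (u n) (hδ n)
    have hnn : ∀ i : ℕ × ℕ, 0 ≤ ‖f i.1 i.2‖ * ‖g i.1 i.2‖ := fun i =>
      mul_nonneg (lp_norm_nonneg _) (lp_norm_nonneg _)
    have hs1 : Summable fun n => ∑' i, ‖f n i‖ * ‖g n i‖ :=
      Summable.of_nonneg_of_le (fun n => tsum_nonneg fun i => hnn (n, i)) (fun n => (e n).le)
        (hu.add hc.summable)
    have hs : Summable fun i : ℕ × ℕ => ‖f i.1 i.2‖ * ‖g i.1 i.2‖ :=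
      (summable_prod_of_nonneg hnn).2 ⟨fun n => (h n).summable, hs1⟩
    refine ⟨fun i => f i.1 i.2, fun i => g i.1 i.2, ⟨hs, fun x => ?_⟩, ?_⟩
    · have hsx : Summable fun i : ℕ × ℕ =>
          convolve μ (g i.1 i.2) (check (f i.1 i.2)) x :=
        Summable.of_norm_bounded hs fun i => norm_convolve_le _ _ x
      have := hsx.hasSum.prod_fiberwise fun n => (h n).hasSum x
      rw [(hw x).unique this]
      exact hsx.hasSum
    · rw [hs.tsum_prod' fun n => (h n).summable]
      calc ∑' n, ∑' i, ‖f n i‖ * ‖g n i‖ ≤ ∑' n, (‖u n‖ + δ n) :=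
            hs1.tsum_le_tsum (fun n => (e n).le) (hu.add hc.summable)
        _ = ∑' n, ‖u n‖ + c := by rw [hu.tsum_add hc.summable, hc.tsum_eq]
        _ ≤ _ := by linarith
  obtain ⟨f, g, h, -⟩ := key 1 one_pos
  obtain ⟨f', g', h', -⟩ := h.exists_nat
  let v : HerzAlgebra p q μ := ⟨w, f', g', h'⟩
  refine ⟨v, rfl, le_of_forall_pos_le_add fun ε hε => ?_⟩
  obtain ⟨f, g, h, e⟩ := key ε hε
  exact (norm_le_of_represents (u := v) h).trans e

instance : CompleteSpace (HerzAlgebra p q μ) := by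
  refine NormedAddCommGroup.completeSpace_of_summable_imp_tendsto fun u hu => ?_
  have hux : ∀ x, Summable fun n => (u n).toFun x := fun x =>
    Summable.of_norm_bounded hu fun n => norm_apply_le _ x
  obtain ⟨v, hv, -⟩ := exists_of_summable u hu (fun x => ∑' n, (u n).toFun x)
    fun x => (hux x).hasSum
  refine ⟨v, ?_⟩
  rw [tendsto_iff_norm_sub_tendsto_zero]
  refine squeeze_zero (fun _ => norm_nonneg _) (fun N => ?_)
    (tendsto_sum_nat_add fun n => ‖u n‖)
  obtain ⟨w, hw, hle⟩ := exists_of_summable (fun n => u (n + N))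
    ((summable_nat_add_iff N).2 hu) (fun x => ∑' n, (u (n + N)).toFun x)
    fun x => ((summable_nat_add_iff N).2 (hux x)).hasSum
  have : ∑ n ∈ Finset.range N, u n - v = -w := by
    refine toFun_injective (funext fun x => ?_)
    have h1 : (-w).toFun x = - w.toFun x := rfl
    rw [h1, toFun_sub, Pi.sub_apply, hv, hw, toFun_sum, Finset.sum_apply]
    simp only
    rw [← (hux x).sum_add_tsum_nat_add N]
    ring
  rw [this, norm_neg]
  exact hle

end Haar

end HerzAlgebra

section Multipliers

variable [TopologicalSpace G] {p q : ℝ≥0∞} {μ : Measure G}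

variable (p q μ) in
/-- The bounded continuous functions `u` on `G` with `u v ∈ A_p(G)` for all `v ∈ A_p(G)`. -/
def multiplierSubmodule : Submodule ℂ (G →ᵇ ℂ) where
  carrier := {u | ∀ v ∈ herzSubmodule p q μ, ⇑u * v ∈ herzSubmodule p q μ}
  add_mem' := by
    intro u₁ u₂ h₁ h₂ v hv
    have := add_mem (h₁ v hv) (h₂ v hv)
    rwa [← add_mul] at this
  zero_mem' := by
    intro v hv
    simp
  smul_mem' := by
    intro c u h v hv
    have := (herzSubmodule p q μ).smul_mem c (h v hv)
    rwa [← smul_mul_assoc] at this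

/-- The multiplier algebra `B_p(G)` of `A_p(G)`. A separate type, so that it carries the
multiplier norm and not the supremum norm. -/
def HerzMultiplier (p q : ℝ≥0∞) (μ : Measure G) : Type _ := ↥(multiplierSubmodule p q μ)

namespace HerzMultiplier

instance : AddCommGroup (HerzMultiplier p q μ) :=
  inferInstanceAs (AddCommGroup ↥(multiplierSubmodule p q μ))

instance : Module ℂ (HerzMultiplier p q μ) :=
  inferInstanceAs (Module ℂ ↥(multiplierSubmodule p q μ))

/-- The bounded continuous function underlying an element of `B_p(G)`. -/
def toBCF (u : HerzMultiplier p q μ) : G →ᵇ ℂ := Subtype.val u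

theorem toBCF_injective : Function.Injective (toBCF : HerzMultiplier p q μ → G →ᵇ ℂ) :=
  Subtype.val_injective

/-- The product `u v ∈ A_p(G)` of `u ∈ B_p(G)` and `v ∈ A_p(G)`. -/
def mul (u : HerzMultiplier p q μ) (v : HerzAlgebra p q μ) : HerzAlgebra p q μ :=
  ⟨⇑u.toBCF * v.toFun, u.2 v.toFun v.2⟩

@[simp] theorem toFun_mul (u : HerzMultiplier p q μ) (v : HerzAlgebra p q μ) :
    (u.mul v).toFun = ⇑u.toBCF * v.toFun := rfl

/-- The norm of `B_p(G)`: `‖u‖ = sup {‖u v‖ : ‖v‖ ≤ 1}`. -/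
instance : Norm (HerzMultiplier p q μ) :=
  ⟨fun u => sSup ((fun v => ‖u.mul v‖) '' {v : HerzAlgebra p q μ | ‖v‖ ≤ 1})⟩

theorem norm_def (u : HerzMultiplier p q μ) :
    ‖u‖ = sSup ((fun v => ‖u.mul v‖) '' {v : HerzAlgebra p q μ | ‖v‖ ≤ 1}) := rfl

section Haar

variable [hpq : p.HolderConjugate q] [MeasurableMul G] [μ.IsMulLeftInvariant]

/-- The multiplication operator `v ↦ u v` on `A_p(G)`; it is bounded by the closed graph theorem. -/
def mulOp (u : HerzMultiplier p q μ) : HerzAlgebra p q μ →L[ℂ] HerzAlgebra p q μ :=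
  ContinuousLinearMap.ofSeqClosedGraph
    (g := { toFun := u.mul
            map_add' := fun v w => HerzAlgebra.toFun_injective (by simp [mul_add])
            map_smul' := fun c v => HerzAlgebra.toFun_injective (by simp) })
    (by
      have cont : ∀ (w : ℕ → HerzAlgebra p q μ) (v : HerzAlgebra p q μ), Tendsto w atTop (𝓝 v) →
          ∀ x, Tendsto (fun n => (w n).toFun x) atTop (𝓝 (v.toFun x)) := by
        intro w v h x
        rw [tendsto_iff_norm_sub_tendsto_zero] at h ⊢
        exact squeeze_zero (fun _ => norm_nonneg _)
          (fun n => HerzAlgebra.norm_apply_le (w n - v) x) h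
      intro w v z hw hz
      refine HerzAlgebra.toFun_injective (funext fun x => ?_)
      exact tendsto_nhds_unique (cont _ _ hz x) ((cont _ _ hw x).const_mul (u.toBCF x)))

@[simp] theorem mulOp_apply (u : HerzMultiplier p q μ) (v : HerzAlgebra p q μ) :
    mulOp u v = u.mul v := rfl

/-- `u ↦ (v ↦ u v)` as a linear map. -/
def mulOpLinear : HerzMultiplier p q μ →ₗ[ℂ] (HerzAlgebra p q μ →L[ℂ] HerzAlgebra p q μ) where
  toFun := mulOp
  map_add' u₁ u₂ := by
    ext v
    refine HerzAlgebra.toFun_injective ?_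
    exact add_mul (⇑u₁.toBCF) (⇑u₂.toBCF) v.toFun
  map_smul' c u := by
    ext v
    refine HerzAlgebra.toFun_injective ?_
    exact smul_mul_assoc c (⇑u.toBCF) v.toFun

theorem norm_eq (u : HerzMultiplier p q μ) : ‖u‖ = ‖mulOpLinear u‖ := by
  rw [← ContinuousLinearMap.sSup_unitClosedBall_eq_norm, norm_def]
  congr 2
  ext v
  simp

end Haar

section LocallyCompact

variable [BorelSpace G] [IsTopologicalGroup G]
  [LocallyCompactSpace G] [μ.IsHaarMeasure]

/-- At every point of `G` some function in `A_p(G)` does not vanish. -/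
theorem exists_toFun_ne_zero (x : G) : ∃ v : HerzAlgebra p q μ, v.toFun x ≠ 0 := by
  obtain ⟨K, hK, hK1⟩ := exists_compact_mem_nhds (1 : G)
  set U : Set G := interior K with hU
  have hUo : IsOpen U := isOpen_interior
  have hUm : MeasurableSet U := hUo.measurableSet
  have hU1 : (1 : G) ∈ U := mem_interior_iff_mem_nhds.2 hK1
  have hUf : μ U ≠ ∞ := ((measure_mono interior_subset).trans_lt hK.measure_lt_top).ne
  have hU0 : μ U ≠ 0 := (hUo.measure_pos μ ⟨1, hU1⟩).ne'
  have hmp : MeasurePreserving (fun y => x⁻¹ * y) μ μ := measurePreserving_mul_left μ x⁻¹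
  set V : Set G := (fun y => x⁻¹ * y) ⁻¹' U with hV
  have hVm : MeasurableSet V := hmp.measurable hUm
  have hVU : μ V = μ U := hmp.measure_preimage hUm.nullMeasurableSet
  let f : Lp ℂ p μ := indicatorConstLp p hUm hUf 1
  let g : Lp ℂ q μ := indicatorConstLp q hVm (hVU ▸ hUf) 1
  have hval : convolve μ g (check f) x = (μ U).toReal := by
    rw [convolve_check]
    have hf : ∀ᵐ y ∂μ, f (x⁻¹ * y) = U.indicator (fun _ => (1 : ℂ)) (x⁻¹ * y) :=
      hmp.quasiMeasurePreserving.ae indicatorConstLp_coeFn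
    have hg : ∀ᵐ y ∂μ, g y = V.indicator (fun _ => (1 : ℂ)) y := indicatorConstLp_coeFn
    have : (fun y => g y * f (x⁻¹ * y)) =ᵐ[μ] V.indicator (fun _ => (1 : ℂ)) := by
      filter_upwards [hf, hg] with y h1 h2
      rw [h1, h2]
      by_cases hy : x⁻¹ * y ∈ U
      · have : y ∈ V := hy
        simp [hy, this]
      · have : y ∉ V := hy
        simp [hy, this]
    rw [integral_congr_ae this, integral_indicator hVm]
    simp [Measure.real, hVU]
  let w : G → ℂ := fun z => convolve μ g (check f) z
  have hrep : Represents (fun _ : Unit => f) (fun _ : Unit => g) w :=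
    ⟨Summable.of_finite, fun z => by simp [w]⟩
  obtain ⟨f', g', h', -⟩ := hrep.exists_nat
  refine ⟨⟨w, f', g', h'⟩, ?_⟩
  change w x ≠ 0
  simp only [w, hval]
  exact_mod_cast (ENNReal.toReal_pos hU0 hUf).ne'

variable [hpq : p.HolderConjugate q]

theorem mulOpLinear_injective : Function.Injective
    (mulOpLinear : HerzMultiplier p q μ →ₗ[ℂ] (HerzAlgebra p q μ →L[ℂ] HerzAlgebra p q μ)) := by
  intro u₁ u₂ h
  refine toBCF_injective (BoundedContinuousFunction.ext fun x => ?_)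
  obtain ⟨v, hv⟩ := exists_toFun_ne_zero (p := p) (q := q) (μ := μ) x
  have h1 : u₁.mul v = u₂.mul v := DFunLike.congr_fun h v
  have h2 : u₁.toBCF x * v.toFun x = u₂.toBCF x * v.toFun x :=
    congrFun (congrArg HerzAlgebra.toFun h1) x
  exact mul_right_cancel₀ hv h2

theorem core : NormedSpace.Core ℂ (HerzMultiplier p q μ) where
  norm_nonneg u := by rw [norm_eq]; exact norm_nonneg _
  norm_smul c u := by rw [norm_eq, norm_eq, map_smul, norm_smul]
  norm_triangle u v := by
    rw [norm_eq, norm_eq, norm_eq, map_add]; exact norm_add_le _ _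
  norm_eq_zero_iff u := by
    rw [norm_eq, norm_eq_zero]
    exact map_eq_zero_iff _ mulOpLinear_injective

instance : NormedAddCommGroup (HerzMultiplier p q μ) := NormedAddCommGroup.ofCore core

instance : NormedSpace ℂ (HerzMultiplier p q μ) := NormedSpace.ofCore core

end LocallyCompact

end HerzMultiplier

end Multipliers

end Herz

end

/-! Each point `x` gives an evaluation functional `δ x` on `B_p(G)`. If any two distinct points `x`,
`y` are separated by some `u` in the unit ball of `B_p(G)` with `u(x) = 1` and `u(y) = 0`, then `‖δ
x - δ y‖ ≥ 1`. A separable dual then forces `G` to be countable, and by Baire a countable locally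
compact Hausdorff group is discrete.

The separating function (`exists_multiplier_separating`) is `u(z) = ∫ h(x⁻¹t)^(1/q) h(z⁻¹t)^(1/p)
dt`, where `h ≥ 0` is continuous with integral one and compact support near the identity. Both
factors are unit vectors, in `L^q` and `L^p`.

The substance is that such a coefficient has multiplier norm at most the product of the norms of its
factors. For compactly supported continuous functions, left invariance gives `(ψ * φ^∨)(x) (ψ' *
φ'^∨)(x) = ∫ (ψ_z * φ_z^∨)(x) dz`, with `φ_z(y) = φ(y) φ'(yz)` and `ψ_z(y) = ψ(y) ψ'(yz)`. The right
side is a Bochner integral in `A_p(G)`, and Hölder in `z` bounds its norm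
(`exists_mul_single_ccLp`). Density of these functions in `L^p` and `L^q`, followed by summation
over a representation, extends the bound to all of `A_p(G)` (`exists_mul_of_ccLp`). -/

/-! ### Density of compactly supported continuous functions in `L^p` -/

section Density

open Set
open scoped NNReal

/-- In a locally compact regular space, `L^p` functions, `p < ∞`, are approximated by continuous
functions with compact support. Normality of the space is not needed. -/
theorem MeasureTheory.MemLp.exists_hasCompactSupport_eLpNorm_sub_le_of_regularSpace
    {α E : Type*} [TopologicalSpace α] [RegularSpace α] [LocallyCompactSpace α]
    [MeasurableSpace α] [BorelSpace α] [NormedAddCommGroup E] [NormedSpace ℝ E]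
    {μ : Measure α} [μ.Regular] {p : ℝ≥0∞} (hp : p ≠ ∞) {f : α → E} (hf : MemLp f p μ)
    {ε : ℝ≥0∞} (hε : ε ≠ 0) :
    ∃ g : α → E, eLpNorm (f - g) p μ ≤ ε ∧ Continuous g ∧ HasCompactSupport g := by
  apply hf.induction_dense hp _ _ _ _ hε
  rotate_left
  · rintro f g ⟨f_cont, hf⟩ ⟨g_cont, hg⟩
    exact ⟨f_cont.add g_cont, hf.add hg⟩
  · rintro f ⟨f_cont, hf⟩
    exact (f_cont.memLp_of_hasCompactSupport (p := p) (μ := μ) hf).aestronglyMeasurable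
  intro c t ht htμ ε hε
  rcases exists_Lp_half E μ p hε with ⟨δ, δpos, hδ⟩
  obtain ⟨η, ηpos, hη⟩ :
      ∃ η : ℝ≥0, 0 < η ∧ ∀ s : Set α, μ s ≤ η → eLpNorm (s.indicator fun _x => c) p μ ≤ δ :=
    exists_eLpNorm_indicator_le hp c δpos.ne'
  have hη_pos' : (η : ℝ≥0∞) ≠ 0 := (ENNReal.coe_pos.2 ηpos).ne'
  -- Urysohn's lemma is available here only for a compact set against a closed one, so `t` is first
  -- shrunk to a compact `s`, which is then enlarged to an open `v`.
  obtain ⟨s, st, s_compact, s_closed, μs⟩ :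
      ∃ s, s ⊆ t ∧ IsCompact s ∧ IsClosed s ∧ μ (t \ s) < η :=
    ht.exists_isCompact_isClosed_sdiff_lt htμ.ne hη_pos'
  obtain ⟨v, sv, v_open, -, μv⟩ : ∃ v, v ⊇ s ∧ IsOpen v ∧ μ v < ∞ ∧ μ (v \ s) < η :=
    s_closed.measurableSet.exists_isOpen_sdiff_lt
      ((measure_mono st).trans_lt htμ).ne hη_pos'
  obtain ⟨g, hgs, hgv, g_supp, hg_range⟩ :=
    exists_continuous_one_zero_of_isCompact s_compact v_open.isClosed_compl
      (disjoint_compl_right_iff_subset.2 sv)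
  have g_cont : Continuous fun x => g x • c := by fun_prop
  have I1 : eLpNorm ((s.indicator fun _y => c) - t.indicator fun _y => c) p μ ≤ δ := by
    rw [← eLpNorm_neg, neg_sub, ← indicator_sdiff st]
    exact hη _ μs.le
  have I2 : eLpNorm ((fun x => g x • c) - s.indicator fun _y => c) p μ ≤ δ := by
    refine (eLpNorm_mono fun x => ?_).trans (hη (v \ s) μv.le)
    by_cases hs : x ∈ s
    · simp [hgs hs, hs]
    · by_cases hv : x ∈ v
      · have hvs : x ∈ v \ s := ⟨hv, hs⟩
        simp only [Pi.sub_apply, hs, not_false_eq_true, indicator_of_notMem, sub_zero, hvs,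
          indicator_of_mem, norm_smul]
        rw [Real.norm_of_nonneg (hg_range x).1]
        exact mul_le_of_le_one_left (norm_nonneg _) (hg_range x).2
      · simp [hgv hv, hs, hv]
  refine ⟨fun x => g x • c, ?_, g_cont, g_supp.smul_right⟩
  have := (hδ _ _ ((g_cont.memLp_of_hasCompactSupport (p := p) (μ := μ)
    g_supp.smul_right).aestronglyMeasurable.sub (aestronglyMeasurable_const.indicator s_closed.measurableSet))
    ((aestronglyMeasurable_const.indicator s_closed.measurableSet).sub
      (aestronglyMeasurable_const.indicator ht)) I2 I1).le
  simpa only [sub_add_sub_cancel] using this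

end Density

/-! ### General lemmas: Baire, separability, extension from a dense subspace -/

/-- A countable locally compact Hausdorff group is discrete. -/
theorem discreteTopology_of_countable_group {G : Type*} [Group G] [TopologicalSpace G]
    [IsTopologicalGroup G] [LocallyCompactSpace G] [T2Space G] [Countable G] :
    DiscreteTopology G := by
  -- Baire: `G` is a countable union of closed singletons, so one of them has an interior point.
  obtain ⟨y, x, hx⟩ := nonempty_interior_of_iUnion_of_closed
    (fun x : G => isClosed_singleton (x := x)) (Set.iUnion_of_singleton G)
  have hxy : x = y := Set.mem_singleton_iff.1 (interior_subset hx)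
  subst hxy
  have ho : IsOpen ({x} : Set G) :=
    interior_eq_iff_isOpen.1 (interior_subset.antisymm (Set.singleton_subset_iff.2 hx))
  refine discreteTopology_of_isOpen_singleton_one ?_
  have := ho.preimage (continuous_const_mul x)
  convert this using 1
  ext z
  simp

/-- An index family whose values are at mutual distance at least `1` in a separable space is
countable. -/
theorem countable_of_one_le_dist {ι E : Type*} [PseudoMetricSpace E]
    [TopologicalSpace.SeparableSpace E] (δ : ι → E) (h : ∀ x y, x ≠ y → 1 ≤ dist (δ x) (δ y)) :
    Countable ι := by
  rw [← Set.countable_univ_iff]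
  refine Set.PairwiseDisjoint.countable_of_isOpen (s := fun x => Metric.ball (δ x) (1 / 2))
    (fun x _ y _ hxy => Metric.ball_disjoint_ball ?_) (fun _ _ => Metric.isOpen_ball)
    (fun x _ => ⟨δ x, Metric.mem_ball_self (by norm_num)⟩)
  have := h x y hxy
  linarith

/-- Lifting along an injection with a norm bound passes from a dense subspace to the closure. -/
theorem exists_lift_of_denseRange {F E X ι : Type*} [AddCommGroup F] [Module ℂ F]
    [NormedAddCommGroup E] [NormedSpace ℂ E] [NormedAddCommGroup X] [NormedSpace ℂ X]
    [CompleteSpace X] (j : F →ₗ[ℂ] E) (hj : DenseRange j) (ev : ι → X →L[ℂ] ℂ)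
    (hev : ∀ w, (∀ i, ev i w = 0) → w = 0) (T : ι → E →L[ℂ] ℂ) {C : ℝ}
    (h : ∀ φ, ∃ w, (∀ i, ev i w = T i (j φ)) ∧ ‖w‖ ≤ C * ‖j φ‖) (e : E) :
    ∃ w, (∀ i, ev i w = T i e) ∧ ‖w‖ ≤ C * ‖e‖ := by
  obtain ⟨b, hb, hbe⟩ := mem_closure_iff_seq_limit.1 (hj e)
  choose φ hφ using hb
  choose w hw hwn using fun n => h (φ n)
  have hdiff : ∀ m n, dist (w m) (w n) ≤ C * dist (b m) (b n) := by
    intro m n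
    -- The lifts `w n` are chosen without any linearity. Since the `ev i` are jointly injective, `w
    -- m - w n` must be the lift of `φ m - φ n`, so the norm bound applies to differences.
    obtain ⟨z, hz, hzn⟩ := h (φ m - φ n)
    have : w m - w n = z := sub_eq_zero.1 <| hev _ fun i => by
      simp [hw, hz]
    rw [dist_eq_norm, dist_eq_norm, this, ← hφ, ← hφ, ← map_sub]
    exact hzn
  have hcau : CauchySeq w := by
    rw [cauchySeq_iff_tendsto_dist_atTop_0]
    have hb0 := (cauchySeq_iff_tendsto_dist_atTop_0.1 hbe.cauchySeq).const_mul C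
    rw [mul_zero] at hb0
    exact squeeze_zero (fun _ => dist_nonneg) (fun n => hdiff _ _) hb0
  obtain ⟨z, hz⟩ := cauchySeq_tendsto_of_complete hcau
  refine ⟨z, fun i => ?_, ?_⟩
  · refine tendsto_nhds_unique (((ev i).continuous.tendsto z).comp hz) ?_
    refine (((T i).continuous.tendsto e).comp hbe).congr fun n => ?_
    simp [hw, hφ]
  · refine le_of_tendsto_of_tendsto hz.norm (hbe.norm.const_mul C) (Eventually.of_forall fun n => ?_)
    simpa [hφ] using hwn n

noncomputable section

namespace Herz

/-! ### Classes in `L^r` of compactly supported continuous functions -/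

section Lift

variable {G : Type*} [TopologicalSpace G] [MeasurableSpace G] [BorelSpace G]
  {μ : Measure G} [IsFiniteMeasureOnCompacts μ]

open scoped CompactlySupported

theorem memLp_cc (r : ℝ≥0∞) (φ : C_c(G, ℂ)) : MemLp φ r μ :=
  φ.continuous.memLp_of_hasCompactSupport φ.hasCompactSupport

variable (μ) in
/-- The class in `L^r` of a continuous function with compact support. -/
def ccLp (r : ℝ≥0∞) : C_c(G, ℂ) →ₗ[ℂ] Lp ℂ r μ where
  toFun φ := (memLp_cc r φ).toLp φ
  map_add' _ _ := rfl
  map_smul' _ _ := rfl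

theorem coeFn_ccLp (r : ℝ≥0∞) (φ : C_c(G, ℂ)) : ccLp μ r φ =ᵐ[μ] φ :=
  (memLp_cc r φ).coeFn_toLp

theorem norm_ccLp_rpow {r : ℝ≥0∞} (h0 : r ≠ 0) (hr : r ≠ ∞) (φ : C_c(G, ℂ)) :
    ‖ccLp μ r φ‖ ^ r.toReal = ∫ y, ‖φ y‖ ^ r.toReal ∂μ := by
  have hnn : 0 ≤ ∫ y, ‖φ y‖ ^ r.toReal ∂μ := integral_nonneg fun _ => by positivity
  change ‖(memLp_cc r φ).toLp φ‖ ^ r.toReal = _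
  rw [Lp.norm_toLp, (memLp_cc r φ).eLpNorm_eq_integral_rpow_norm h0 hr,
    ENNReal.toReal_ofReal (by positivity), Real.rpow_inv_rpow hnn]
  exact (ENNReal.toReal_pos h0 hr).ne'

/-- A jointly continuous family with supports in a common compact set is continuous in `L^r`. -/
theorem continuous_ccLp {Z : Type*} [TopologicalSpace Z] {r : ℝ≥0∞} [Fact (1 ≤ r)] (hr : r ≠ ∞)
    (Φ : Z → C_c(G, ℂ)) (hΦ : Continuous fun w : Z × G => Φ w.1 w.2) {K : Set G}
    (hK : IsCompact K) (hs : ∀ z, ∀ y ∉ K, Φ z y = 0) : Continuous fun z => ccLp μ r (Φ z) := by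
  have h0 : r ≠ 0 := (zero_lt_one.trans_le Fact.out).ne'
  have hr0 : 0 < r.toReal := ENNReal.toReal_pos h0 hr
  rw [continuous_iff_continuousAt]
  intro z₀
  rw [ContinuousAt, tendsto_iff_norm_sub_tendsto_zero]
  -- This is the `r`-th power of the `L^r` distance: an integral over the fixed compact `K` of a
  -- jointly continuous function, which vanishes at `z₀`.
  have hc : Continuous fun z => ∫ y, ‖(Φ z - Φ z₀) y‖ ^ r.toReal ∂μ := by
    rw [← continuousOn_univ]
    refine continuousOn_integral_of_compact_support hK ?_ ?_
    · refine Continuous.continuousOn ?_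
      have h₀ : Continuous fun w : Z × G => Φ z₀ w.2 := (Φ z₀).continuous.comp continuous_snd
      exact (hΦ.sub h₀).norm.rpow_const fun _ => Or.inr hr0.le
    · intro z y _ hy
      simp [hs z y hy, hs z₀ y hy, hr0.ne']
  have h1 := (hc.tendsto z₀).rpow_const (p := r.toReal⁻¹) (Or.inr (by positivity))
  simp only [sub_self, CompactlySupportedContinuousMap.coe_zero, Pi.zero_apply, norm_zero,
    Real.zero_rpow hr0.ne', integral_zero, Real.zero_rpow (inv_pos.2 hr0).ne'] at h1
  refine h1.congr fun z => ?_
  rw [← norm_ccLp_rpow h0 hr, Real.rpow_rpow_inv (norm_nonneg _) hr0.ne', map_sub]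

end Lift

open scoped CompactlySupported in
theorem denseRange_ccLp {G : Type*} [TopologicalSpace G] [MeasurableSpace G] [BorelSpace G]
    [RegularSpace G] [LocallyCompactSpace G] {μ : Measure G} [μ.Regular] {r : ℝ≥0∞} [Fact (1 ≤ r)]
    (hr : r ≠ ∞) : DenseRange (ccLp μ r : C_c(G, ℂ) →ₗ[ℂ] Lp ℂ r μ) := by
  intro f
  refine EMetric.mem_closure_iff.2 fun ε hε => ?_
  obtain ⟨δ, hδ, hδε⟩ := exists_between hε
  obtain ⟨g, hg, gc, gs⟩ :=
    (Lp.memLp f).exists_hasCompactSupport_eLpNorm_sub_le_of_regularSpace hr hδ.ne'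
  refine ⟨_, ⟨⟨⟨g, gc⟩, gs⟩, rfl⟩, ?_⟩
  rw [Lp.edist_def, eLpNorm_congr_ae (EventuallyEq.rfl.sub (coeFn_ccLp r _))]
  exact hg.trans_lt hδε

/-! ### The products `φ(y) φ'(yz)` as a family in `z` -/

section Translate

open scoped CompactlySupported

variable {G : Type*} [Group G] [TopologicalSpace G] [IsTopologicalGroup G]

/-- The function `y ↦ φ(y) φ'(yz)`. -/
def mulTranslate (φ φ' : C_c(G, ℂ)) (z : G) : C_c(G, ℂ) where
  toFun y := φ y * φ' (y * z)
  hasCompactSupport' := φ.hasCompactSupport.mul_right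

@[simp] theorem mulTranslate_apply (φ φ' : C_c(G, ℂ)) (z y : G) :
    mulTranslate φ φ' z y = φ y * φ' (y * z) := rfl

theorem continuous_mulTranslate (φ φ' : C_c(G, ℂ)) :
    Continuous fun w : G × G => mulTranslate φ φ' w.1 w.2 := by
  simp only [mulTranslate_apply]
  fun_prop

/-- A nonzero value forces `y ∈ supp φ` and `yz ∈ supp φ'`, hence `z ∈ (supp φ)⁻¹ supp φ'`. Compact
support in both variables jointly is what permits interchanging integrals although `μ` need not be
σ-finite. -/
theorem hasCompactSupport_mulTranslate (φ φ' : C_c(G, ℂ)) :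
    HasCompactSupport fun w : G × G => mulTranslate φ φ' w.2 w.1 := by
  have hK := φ.hasCompactSupport.isCompact
  have hK' := φ'.hasCompactSupport.isCompact
  refine HasCompactSupport.intro (hK.prod (hK.inv.mul hK')) fun w hw => ?_
  by_contra h
  have h1 := subset_tsupport _ (left_ne_zero_of_mul h)
  have h2 := subset_tsupport _ (right_ne_zero_of_mul h)
  exact hw ⟨h1, Set.mem_mul.2 ⟨w.1⁻¹, Set.inv_mem_inv.2 h1, w.1 * w.2, h2, by simp⟩⟩

theorem hasCompactSupport_mulTranslate_right (φ φ' : C_c(G, ℂ)) :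
    HasCompactSupport fun z : G => mulTranslate φ φ' z := by
  have hK := (hasCompactSupport_mulTranslate φ φ').isCompact.image continuous_snd
  refine HasCompactSupport.intro hK fun z hz => ?_
  ext y
  by_contra h
  exact hz ⟨(y, z), subset_tsupport _ h, rfl⟩

variable [MeasurableSpace G] [BorelSpace G] {μ : Measure G} [IsFiniteMeasureOnCompacts μ]

theorem continuous_ccLp_mulTranslate {r : ℝ≥0∞} [Fact (1 ≤ r)] (hr : r ≠ ∞) (φ φ' : C_c(G, ℂ)) :
    Continuous fun z => ccLp μ r (mulTranslate φ φ' z) :=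
  continuous_ccLp hr _ (continuous_mulTranslate φ φ') φ.hasCompactSupport.isCompact
    fun z y hy => by simp [image_eq_zero_of_notMem_tsupport hy]

theorem hasCompactSupport_ccLp_mulTranslate {r : ℝ≥0∞} (φ φ' : C_c(G, ℂ)) :
    HasCompactSupport fun z => ccLp μ r (mulTranslate φ φ' z) :=
  (hasCompactSupport_mulTranslate_right φ φ').comp_left (map_zero _)

/-- After integrating in `z` first, left invariance makes the integral of `‖φ'(yz)‖ ^ r` independent
of `y`, and the double integral factors. -/
theorem integral_norm_ccLp_mulTranslate [μ.IsMulLeftInvariant] {r : ℝ≥0∞} (h0 : r ≠ 0)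
    (hr : r ≠ ∞) (φ φ' : C_c(G, ℂ)) :
    ∫ z, ‖ccLp μ r (mulTranslate φ φ' z)‖ ^ r.toReal ∂μ =
      ‖ccLp μ r φ‖ ^ r.toReal * ‖ccLp μ r φ'‖ ^ r.toReal := by
  have hr0 : 0 < r.toReal := ENNReal.toReal_pos h0 hr
  simp only [norm_ccLp_rpow h0 hr]
  rw [← integral_integral_swap_of_hasCompactSupport
    (f := fun y z => ‖mulTranslate φ φ' z y‖ ^ r.toReal)]
  · simp only [mulTranslate_apply, norm_mul, Real.mul_rpow (norm_nonneg _) (norm_nonneg _)]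
    simp only [integral_const_mul, integral_mul_left_eq_self (fun z => ‖φ' z‖ ^ r.toReal),
      integral_mul_const]
  · exact ((continuous_mulTranslate φ φ').comp continuous_swap).norm.rpow_const
      fun _ => Or.inr hr0.le
  · exact (hasCompactSupport_mulTranslate φ φ').comp_left (g := fun c => ‖c‖ ^ r.toReal)
      (by simp [hr0.ne'])

end Translate

/-! ### Elementary coefficients `g * f^∨` and point evaluations on `A_p(G)` -/

section Single

variable {G : Type*} [Group G] [MeasurableSpace G] {p q : ℝ≥0∞} {μ : Measure G}

/-- The coefficient function `g * f^∨` as an element of `A_p(G)`. -/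
def single (f : Lp ℂ p μ) (g : Lp ℂ q μ) : HerzAlgebra p q μ :=
  ⟨fun x => convolve μ g (check f) x, by
    have h : Represents (fun _ : Unit => f) (fun _ : Unit => g)
        (fun x => convolve μ g (check f) x) := ⟨Summable.of_finite, fun x => by simp⟩
    obtain ⟨f', g', h', -⟩ := h.exists_nat
    exact ⟨f', g', h'⟩⟩

@[simp] theorem toFun_single (f : Lp ℂ p μ) (g : Lp ℂ q μ) (x : G) :
    (single f g).toFun x = convolve μ g (check f) x := rfl

theorem norm_single_le (f : Lp ℂ p μ) (g : Lp ℂ q μ) : ‖single f g‖ ≤ ‖f‖ * ‖g‖ := by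
  have h : Represents (fun _ : Unit => f) (fun _ : Unit => g) (single f g).toFun :=
    ⟨Summable.of_finite, fun x => by simp⟩
  simpa using HerzAlgebra.norm_le_of_represents h

variable [MeasurableMul G] [μ.IsMulLeftInvariant]

theorem convolve_check_congr {f f' g g' : G → ℂ} (hf : f =ᵐ[μ] f') (hg : g =ᵐ[μ] g') (x : G) :
    convolve μ g (check f) x = convolve μ g' (check f') x := by
  rw [convolve_check, convolve_check]
  refine integral_congr_ae ?_
  filter_upwards [(measurePreserving_mul_left μ x⁻¹).quasiMeasurePreserving.ae_eq_comp hf, hg]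
    with y h1 h2
  simp only [Function.comp_apply] at h1
  rw [h1, h2]

variable [hpq : p.HolderConjugate q]

theorem integrable_mul_translate {f g : G → ℂ} (hf : MemLp f p μ) (hg : MemLp g q μ) (x : G) :
    Integrable (fun y => g y * f (x⁻¹ * y)) μ := by
  have := hg.integrable_mul (hf.comp_measurePreserving (measurePreserving_mul_left μ x⁻¹))
  exact this

theorem single_add_left (f f' : Lp ℂ p μ) (g : Lp ℂ q μ) :
    single (f + f') g = single f g + single f' g := by
  refine HerzAlgebra.toFun_injective (funext fun x => ?_)
  simp only [HerzAlgebra.toFun_add, Pi.add_apply, toFun_single]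
  rw [convolve_check_congr (Lp.coeFn_add f f') EventuallyEq.rfl]
  simp only [convolve_check, Pi.add_apply, mul_add]
  exact integral_add (integrable_mul_translate (Lp.memLp f) (Lp.memLp g) x)
    (integrable_mul_translate (Lp.memLp f') (Lp.memLp g) x)

theorem single_add_right (f : Lp ℂ p μ) (g g' : Lp ℂ q μ) :
    single f (g + g') = single f g + single f g' := by
  refine HerzAlgebra.toFun_injective (funext fun x => ?_)
  simp only [HerzAlgebra.toFun_add, Pi.add_apply, toFun_single]
  rw [convolve_check_congr EventuallyEq.rfl (Lp.coeFn_add g g')]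
  simp only [convolve_check, Pi.add_apply, add_mul]
  exact integral_add (integrable_mul_translate (Lp.memLp f) (Lp.memLp g) x)
    (integrable_mul_translate (Lp.memLp f) (Lp.memLp g') x)

omit hpq in
theorem single_smul_left (c : ℂ) (f : Lp ℂ p μ) (g : Lp ℂ q μ) :
    single (c • f) g = c • single f g := by
  refine HerzAlgebra.toFun_injective (funext fun x => ?_)
  simp only [HerzAlgebra.toFun_smul, Pi.smul_apply, toFun_single]
  rw [convolve_check_congr (Lp.coeFn_smul c f) EventuallyEq.rfl]
  simp only [convolve_check, Pi.smul_apply, smul_eq_mul, mul_left_comm _ c, integral_const_mul]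

omit hpq [MeasurableMul G] [μ.IsMulLeftInvariant] in
theorem single_smul_right (c : ℂ) (f : Lp ℂ p μ) (g : Lp ℂ q μ) :
    single f (c • g) = c • single f g := by
  refine HerzAlgebra.toFun_injective (funext fun x => ?_)
  simpa using convolve_smul_left c g _ x

variable (p q μ) in
/-- The map `(f, g) ↦ g * f^∨` as a bounded bilinear map. -/
def singleL [Fact (1 ≤ p)] [Fact (1 ≤ q)] : Lp ℂ p μ →L[ℂ] Lp ℂ q μ →L[ℂ] HerzAlgebra p q μ :=
  LinearMap.mkContinuous₂ (LinearMap.mk₂ ℂ single single_add_left single_smul_left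
    single_add_right single_smul_right) 1 fun f g => by simpa using norm_single_le f g

@[simp] theorem singleL_apply [Fact (1 ≤ p)] [Fact (1 ≤ q)] (f : Lp ℂ p μ) (g : Lp ℂ q μ) :
    singleL p q μ f g = single f g := rfl

variable (p q μ) in
/-- Evaluation at a point as a bounded functional on `A_p(G)`. -/
def evalL (x : G) : HerzAlgebra p q μ →L[ℂ] ℂ :=
  LinearMap.mkContinuous
    { toFun := fun u => u.toFun x, map_add' := fun _ _ => rfl, map_smul' := fun _ _ => rfl } 1
    fun u => (HerzAlgebra.norm_apply_le u x).trans_eq (one_mul _).symm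

@[simp] theorem evalL_apply (x : G) (u : HerzAlgebra p q μ) : evalL p q μ x u = u.toFun x := rfl

theorem eq_zero_of_evalL (w : HerzAlgebra p q μ) (h : ∀ x, evalL p q μ x w = 0) : w = 0 :=
  HerzAlgebra.toFun_injective (funext h)

end Single

/-! ### Products of two coefficients -/

section Product

open scoped CompactlySupported

variable {G : Type*} [Group G] [TopologicalSpace G] [IsTopologicalGroup G]
  [MeasurableSpace G] [BorelSpace G] {μ : Measure G} [IsFiniteMeasureOnCompacts μ]
  [μ.IsMulLeftInvariant] {p q : ℝ≥0∞}

theorem toFun_single_ccLp (φ ψ : C_c(G, ℂ)) (x : G) :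
    (single (ccLp μ p φ) (ccLp μ q ψ)).toFun x = ∫ y, ψ y * φ (x⁻¹ * y) ∂μ := by
  rw [toFun_single, convolve_check_congr (coeFn_ccLp p φ) (coeFn_ccLp q ψ), convolve_check]

variable [Fact (1 ≤ p)] [Fact (1 ≤ q)] [hpq : p.HolderConjugate q]

/-- Hölder in the variable `z`; each factor is then computed exactly by
`integral_norm_ccLp_mulTranslate`. This yields the constant one in the product estimate. -/
theorem integral_norm_mul_norm_le (hp : p ≠ ∞) (hq : q ≠ ∞) (φ ψ φ' ψ' : C_c(G, ℂ)) :
    ∫ z, ‖ccLp μ p (mulTranslate φ φ' z)‖ * ‖ccLp μ q (mulTranslate ψ ψ' z)‖ ∂μ ≤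
      (‖ccLp μ p φ‖ * ‖ccLp μ p φ'‖) * (‖ccLp μ q ψ‖ * ‖ccLp μ q ψ'‖) := by
  have hp0 : p ≠ 0 := (zero_lt_one.trans_le Fact.out).ne'
  have hq0 : q ≠ 0 := (zero_lt_one.trans_le Fact.out).ne'
  have hpq' : p.toReal.HolderConjugate q.toReal :=
    ENNReal.HolderConjugate.toReal_of_ne_top hp hq
  have hF : MemLp (fun z => ‖ccLp μ p (mulTranslate φ φ' z)‖) (ENNReal.ofReal p.toReal) μ :=
    (continuous_ccLp_mulTranslate hp φ φ').norm.memLp_of_hasCompactSupport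
      (hasCompactSupport_ccLp_mulTranslate (μ := μ) (r := p) φ φ').norm
  have hH : MemLp (fun z => ‖ccLp μ q (mulTranslate ψ ψ' z)‖) (ENNReal.ofReal q.toReal) μ :=
    (continuous_ccLp_mulTranslate hq ψ ψ').norm.memLp_of_hasCompactSupport
      (hasCompactSupport_ccLp_mulTranslate (μ := μ) (r := q) ψ ψ').norm
  have key := integral_mul_le_Lp_mul_Lq_of_nonneg hpq'
    (Eventually.of_forall fun _ => norm_nonneg _) (Eventually.of_forall fun _ => norm_nonneg _)
    hF hH
  have e1 : ∀ {r a b : ℝ}, r ≠ 0 → 0 ≤ a → 0 ≤ b → (a ^ r * b ^ r) ^ (1 / r) = a * b := by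
    intro r a b hr ha hb
    rw [← Real.mul_rpow ha hb, one_div, Real.rpow_rpow_inv (by positivity) hr]
  rwa [integral_norm_ccLp_mulTranslate hp0 hp, integral_norm_ccLp_mulTranslate hq0 hq,
    e1 hpq'.pos.ne' (norm_nonneg _) (norm_nonneg _),
    e1 hpq'.symm.pos.ne' (norm_nonneg _) (norm_nonneg _)] at key

/-- Products of coefficients of compactly supported continuous functions are in `A_p(G)`. -/
theorem exists_mul_single_ccLp (hp : p ≠ ∞) (hq : q ≠ ∞) (φ ψ φ' ψ' : C_c(G, ℂ)) :
    ∃ w : HerzAlgebra p q μ, (∀ x, w.toFun x = (single (ccLp μ p φ) (ccLp μ q ψ)).toFun x *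
        (single (ccLp μ p φ') (ccLp μ q ψ')).toFun x) ∧
      ‖w‖ ≤ (‖ccLp μ p φ‖ * ‖ccLp μ q ψ‖) * (‖ccLp μ p φ'‖ * ‖ccLp μ q ψ'‖) := by
  -- The product is `∫ W z dz`, an integral in the Banach space `A_p(G)`; `W` is continuous with
  -- compact support, so the integral exists.
  let W : G → HerzAlgebra p q μ := fun z =>
    singleL p q μ (ccLp μ p (mulTranslate φ φ' z)) (ccLp μ q (mulTranslate ψ ψ' z))
  have hWc : Continuous W := by
    have h1 := continuous_ccLp_mulTranslate (μ := μ) hp φ φ'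
    have h2 := continuous_ccLp_mulTranslate (μ := μ) hq ψ ψ'
    exact ((singleL p q μ).continuous.comp h1).clm_apply h2
  have hWs : HasCompactSupport W := by
    refine (hasCompactSupport_ccLp_mulTranslate (μ := μ) (r := p) φ φ').mono fun z hz h => hz ?_
    have h' : ccLp μ p (mulTranslate φ φ' z) = 0 := h
    simp only [W]
    rw [h', map_zero, zero_apply]
  have hWi : Integrable W μ := hWc.integrable_of_hasCompactSupport hWs
  refine ⟨∫ z, W z ∂μ, fun x => ?_, ?_⟩
  -- Evaluation at `x` is a bounded functional, so it passes under the integral and reduces the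
  -- identity to scalar integrals.
  · rw [← evalL_apply, ← ContinuousLinearMap.integral_comp_comm _ hWi]
    simp only [W, singleL_apply, evalL_apply, toFun_single_ccLp, mulTranslate_apply]
    rw [← integral_integral_swap_of_hasCompactSupport
      (f := fun y z => ψ y * ψ' (y * z) * (φ (x⁻¹ * y) * φ' (x⁻¹ * y * z)))]
    · rw [← integral_mul_const]
      refine integral_congr_ae (Eventually.of_forall fun y => ?_)
      simp only [mul_mul_mul_comm (ψ y), integral_const_mul, mul_assoc x⁻¹]
      -- Replacing `yz` by `z` decouples the two integrals.
      rw [integral_mul_left_eq_self (fun z => ψ' z * φ' (x⁻¹ * z))]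
    · change Continuous fun w : G × G =>
        ψ w.1 * ψ' (w.1 * w.2) * (φ (x⁻¹ * w.1) * φ' (x⁻¹ * w.1 * w.2))
      fun_prop
    · exact (hasCompactSupport_mulTranslate ψ ψ').mul_right
  · refine (norm_integral_le_integral_norm _).trans ?_
    have hFH : Integrable (fun z =>
        ‖ccLp μ p (mulTranslate φ φ' z)‖ * ‖ccLp μ q (mulTranslate ψ ψ' z)‖) μ := by
      refine Continuous.integrable_of_hasCompactSupport ?_ ?_
      · exact (continuous_ccLp_mulTranslate hp φ φ').norm.mul
          (continuous_ccLp_mulTranslate hq ψ ψ').norm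
      · exact (hasCompactSupport_ccLp_mulTranslate (μ := μ) (r := p) φ φ').norm.mul_right
    refine (integral_mono hWi.norm hFH fun z => norm_single_le _ _).trans ?_
    refine (integral_norm_mul_norm_le hp hq φ ψ φ' ψ').trans_eq ?_
    ring

end Product

/-! ### Coefficients as multipliers, and evaluations on `B_p(G)` -/

section Multiplier

open scoped CompactlySupported

variable {G : Type*} [Group G] [TopologicalSpace G] [IsTopologicalGroup G]
  [LocallyCompactSpace G] [MeasurableSpace G] [BorelSpace G] {μ : Measure G} [μ.IsHaarMeasure]
  {p q : ℝ≥0∞} [Fact (1 ≤ p)] [Fact (1 ≤ q)] [hpq : p.HolderConjugate q]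

/-- Density is used one variable at a time: `φ'` is replaced by `f` with `ψ'` fixed, then `ψ'` by
`g`. An element of `A_p(G)` is determined by its point values, as `exists_lift_of_denseRange`
requires. -/
theorem exists_mul_of_single [μ.Regular] (hp : p ≠ ∞) (hq : q ≠ ∞) (φ ψ : C_c(G, ℂ))
    (f : Lp ℂ p μ) (g : Lp ℂ q μ) :
    ∃ w : HerzAlgebra p q μ, (∀ x, w.toFun x =
        (single (ccLp μ p φ) (ccLp μ q ψ)).toFun x * (single f g).toFun x) ∧
      ‖w‖ ≤ (‖ccLp μ p φ‖ * ‖ccLp μ q ψ‖) * (‖f‖ * ‖g‖) := by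
  set u := single (ccLp μ p φ) (ccLp μ q ψ) with hu
  set C := ‖ccLp μ p φ‖ * ‖ccLp μ q ψ‖
  have left : ∀ ψ' : C_c(G, ℂ), ∃ w : HerzAlgebra p q μ,
      (∀ x, w.toFun x = u.toFun x * (single f (ccLp μ q ψ')).toFun x) ∧
        ‖w‖ ≤ (C * ‖ccLp μ q ψ'‖) * ‖f‖ := by
    intro ψ'
    refine exists_lift_of_denseRange (ccLp μ p) (denseRange_ccLp hp) (evalL p q μ)
      eq_zero_of_evalL
      (fun x => u.toFun x • (evalL p q μ x).comp ((singleL p q μ).flip (ccLp μ q ψ')))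
      (fun φ' => ?_) f
    obtain ⟨w, h1, h2⟩ := exists_mul_single_ccLp (μ := μ) hp hq φ ψ φ' ψ'
    exact ⟨w, h1, h2.trans_eq (by ring)⟩
  obtain ⟨w, h1, h2⟩ := exists_lift_of_denseRange (ccLp μ q) (denseRange_ccLp hq) (evalL p q μ)
    eq_zero_of_evalL (fun x => u.toFun x • (evalL p q μ x).comp (singleL p q μ f))
    (C := C * ‖f‖) (fun ψ' => by
      obtain ⟨w, h1, h2⟩ := left ψ'
      exact ⟨w, h1, h2.trans_eq (by ring)⟩) g
  exact ⟨w, h1, h2.trans_eq (by ring)⟩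

/-- Multiplication by a coefficient of compactly supported continuous functions maps `A_p(G)` to
itself. -/
theorem exists_mul_of_ccLp [μ.Regular] (hp : p ≠ ∞) (hq : q ≠ ∞) (φ ψ : C_c(G, ℂ))
    (v : HerzAlgebra p q μ) :
    ∃ w : HerzAlgebra p q μ,
      w.toFun = (single (ccLp μ p φ) (ccLp μ q ψ)).toFun * v.toFun ∧
      ‖w‖ ≤ (‖ccLp μ p φ‖ * ‖ccLp μ q ψ‖) * ‖v‖ := by
  set u := single (ccLp μ p φ) (ccLp μ q ψ)
  set C := ‖ccLp μ p φ‖ * ‖ccLp μ q ψ‖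
  have hC : 0 ≤ C := mul_nonneg (norm_nonneg _) (norm_nonneg _)
  -- A representation of `v` of cost below `‖v‖ + ε` is multiplied term by term, and the products
  -- are summed in `A_p(G)`.
  have key : ∀ ε : ℝ, 0 < ε → ∃ w : HerzAlgebra p q μ,
      w.toFun = u.toFun * v.toFun ∧ ‖w‖ ≤ C * (‖v‖ + ε) := by
    intro ε hε
    obtain ⟨f, g, h, hn⟩ := HerzAlgebra.exists_represents v hε
    choose w hw hwn using fun n => exists_mul_of_single hp hq φ ψ (f n) (g n)
    have hs : Summable fun n => ‖w n‖ :=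
      Summable.of_nonneg_of_le (fun _ => norm_nonneg _) hwn (h.summable.mul_left C)
    obtain ⟨z, hz, hzn⟩ := HerzAlgebra.exists_of_summable w hs (u.toFun * v.toFun) fun x =>
      by
      simp only [hw, toFun_single]
      exact (h.hasSum x).mul_left (u.toFun x)
    refine ⟨z, hz, hzn.trans ((hs.tsum_le_tsum hwn (h.summable.mul_left C)).trans ?_)⟩
    rw [tsum_mul_left]
    exact mul_le_mul_of_nonneg_left hn.le hC
  obtain ⟨w, hw, -⟩ := key 1 one_pos
  refine ⟨w, hw, ?_⟩
  -- The element does not depend on `ε`, its values being prescribed, so `ε` may tend to zero in the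
  -- bound.
  have hlim : Tendsto (fun ε : ℝ => C * (‖v‖ + ε)) (𝓝[>] 0) (𝓝 (C * (‖v‖ + 0))) :=
    ((continuous_const.add continuous_id).const_mul C).continuousWithinAt
  rw [add_zero] at hlim
  refine ge_of_tendsto hlim (eventually_mem_nhdsWithin.mono fun ε hε => ?_)
  obtain ⟨w', hw', hn⟩ := key ε hε
  rwa [HerzAlgebra.toFun_injective (hw.trans hw'.symm)]

omit [LocallyCompactSpace G] [Fact (1 ≤ p)] [Fact (1 ≤ q)] hpq in
theorem continuous_toFun_single_ccLp (φ ψ : C_c(G, ℂ)) :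
    Continuous (single (ccLp μ p φ) (ccLp μ q ψ)).toFun := by
  rw [funext (toFun_single_ccLp φ ψ), ← continuousOn_univ]
  refine continuousOn_integral_of_compact_support ψ.hasCompactSupport.isCompact
    (Continuous.continuousOn ?_) fun x y _ hy => by simp [image_eq_zero_of_notMem_tsupport hy]
  change Continuous fun w : G × G => ψ w.2 * φ (w.1⁻¹ * w.2)
  fun_prop

/-- A coefficient of compactly supported continuous functions as an element of `B_p(G)`. -/
def coefficient [μ.Regular] (hp : p ≠ ∞) (hq : q ≠ ∞) (φ ψ : C_c(G, ℂ)) : HerzMultiplier p q μ :=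
  ⟨BoundedContinuousFunction.ofNormedAddCommGroup (single (ccLp μ p φ) (ccLp μ q ψ)).toFun
    (continuous_toFun_single_ccLp φ ψ) _ (HerzAlgebra.norm_apply_le _), fun v hv => by
      obtain ⟨w, hw, -⟩ := exists_mul_of_ccLp hp hq φ ψ (⟨v, hv⟩ : HerzAlgebra p q μ)
      exact hw ▸ w.2⟩

theorem coefficient_apply [μ.Regular] (hp : p ≠ ∞) (hq : q ≠ ∞) (φ ψ : C_c(G, ℂ)) (x : G) :
    (coefficient (μ := μ) hp hq φ ψ).toBCF x = ∫ y, ψ y * φ (x⁻¹ * y) ∂μ :=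
  toFun_single_ccLp φ ψ x

theorem norm_coefficient_le [μ.Regular] (hp : p ≠ ∞) (hq : q ≠ ∞) (φ ψ : C_c(G, ℂ)) :
    ‖coefficient (μ := μ) hp hq φ ψ‖ ≤ ‖ccLp μ p φ‖ * ‖ccLp μ q ψ‖ := by
  have hC : 0 ≤ ‖ccLp μ p φ‖ * ‖ccLp μ q ψ‖ := mul_nonneg (norm_nonneg _) (norm_nonneg _)
  rw [HerzMultiplier.norm_def]
  refine Real.sSup_le ?_ hC
  rintro _ ⟨v, hv, rfl⟩
  obtain ⟨w, hw, hn⟩ := exists_mul_of_ccLp hp hq φ ψ v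
  have : (coefficient hp hq φ ψ).mul v = w := HerzAlgebra.toFun_injective hw.symm
  simp only [this]
  exact hn.trans (mul_le_of_le_one_right hC hv)

omit [Fact (1 ≤ p)] [Fact (1 ≤ q)] in
/-- Evaluation at a point as a bounded functional on `B_p(G)`. -/
theorem exists_evaluation (x : G) :
    ∃ δ : StrongDual ℂ (HerzMultiplier p q μ), ∀ u, δ u = u.toBCF x := by
  -- From `|u(x) v(x)| ≤ ‖u v‖ ≤ ‖u‖ ‖v‖` the functional has norm at most `‖v‖ / |v(x)|`; any finite
  -- bound suffices.
  obtain ⟨v, hv⟩ := HerzMultiplier.exists_toFun_ne_zero (p := p) (q := q) (μ := μ) x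
  have hv' : 0 < ‖v.toFun x‖ := norm_pos_iff.2 hv
  refine ⟨LinearMap.mkContinuous
    { toFun := fun u : HerzMultiplier p q μ => u.toBCF x
      map_add' := fun _ _ => rfl
      map_smul' := fun _ _ => rfl } (‖v‖ / ‖v.toFun x‖) fun u => ?_, fun u => rfl⟩
  change ‖u.toBCF x‖ ≤ _
  rw [div_mul_eq_mul_div, le_div_iff₀ hv', ← norm_mul, mul_comm ‖v‖, HerzMultiplier.norm_eq]
  exact (HerzAlgebra.norm_apply_le (u.mul v) x).trans
    ((HerzMultiplier.mulOpLinear u).le_opNorm v)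

end Multiplier

/-! ### Separating two points by the unit ball of `B_p(G)` -/

section Separation

open scoped CompactlySupported

variable {G : Type*} [Group G] [TopologicalSpace G] [IsTopologicalGroup G]

/-- The function `t ↦ h(x⁻¹t)^s`. -/
def rpowTranslate (h : C_c(G, ℝ)) {s : ℝ} (hs : 0 < s) (x : G) : C_c(G, ℂ) where
  toFun t := ((h (x⁻¹ * t) ^ s : ℝ) : ℂ)
  continuous_toFun := Complex.continuous_ofReal.comp
    ((h.continuous.comp (continuous_const_mul x⁻¹)).rpow_const fun _ => Or.inr hs.le)
  hasCompactSupport' := (h.hasCompactSupport.comp_homeomorph (Homeomorph.mulLeft x⁻¹)).comp_left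
    (g := fun a : ℝ => ((a ^ s : ℝ) : ℂ)) (by simp [hs.ne'])

theorem rpowTranslate_apply (h : C_c(G, ℝ)) {s : ℝ} (hs : 0 < s) (x t : G) :
    rpowTranslate h hs x t = ((h (x⁻¹ * t) ^ s : ℝ) : ℂ) := rfl

variable [MeasurableSpace G] [BorelSpace G] {μ : Measure G}

/-- With exponent `1/r`, the `r`-th power of the function is a translate of `h`, whose integral is
one by left invariance. -/
theorem norm_ccLp_rpowTranslate [IsFiniteMeasureOnCompacts μ] [μ.IsMulLeftInvariant]
    {r : ℝ≥0∞} [Fact (1 ≤ r)] (hr : r ≠ ∞)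
    (h : C_c(G, ℝ)) (h0 : ∀ t, 0 ≤ h t) (h1 : ∫ t, h t ∂μ = 1) (hs : 0 < r.toReal⁻¹) (x : G) :
    ‖ccLp μ r (rpowTranslate h hs x)‖ = 1 := by
  have hr' : r.toReal ≠ 0 := (inv_pos.1 hs).ne'
  have key := norm_ccLp_rpow (μ := μ) (zero_lt_one.trans_le Fact.out).ne' hr (rpowTranslate h hs x)
  have : ∀ t, ‖rpowTranslate h hs x t‖ ^ r.toReal = h (x⁻¹ * t) := fun t => by
    rw [rpowTranslate_apply, Complex.norm_real,
      Real.norm_of_nonneg (Real.rpow_nonneg (h0 _) _), Real.rpow_inv_rpow (h0 _) hr']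
  simp only [this, integral_mul_left_eq_self (fun t => h t), h1] at key
  rw [← Real.rpow_rpow_inv (norm_nonneg (ccLp μ r (rpowTranslate h hs x))) hr', key, Real.one_rpow]

theorem exists_bump [LocallyCompactSpace G] [μ.IsHaarMeasure] {W : Set G}
    (hW : IsOpen W) (h1W : 1 ∈ W) :
    ∃ h : C_c(G, ℝ), (∀ t, 0 ≤ h t) ∧ ∫ t, h t ∂μ = 1 ∧ ∀ t ∉ W, h t = 0 := by
  obtain ⟨f, f1, fW, fs, fr⟩ := exists_continuous_one_zero_of_isCompact
    (isCompact_singleton (x := (1 : G))) hW.isClosed_compl (by simpa using h1W)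
  have hpos : 0 < ∫ t, f t ∂μ := f.continuous.integral_pos_of_hasCompactSupport_nonneg_nonzero
    (x := 1) fs (fun t => (fr t).1) (by simp [f1 rfl])
  refine ⟨(∫ t, f t ∂μ)⁻¹ • ⟨f, fs⟩, fun t => ?_, ?_, fun t ht => ?_⟩
  · exact mul_nonneg (inv_pos.2 hpos).le (fr t).1
  · change ∫ t, (∫ t, f t ∂μ)⁻¹ * f t ∂μ = 1
    rw [integral_const_mul, inv_mul_cancel₀ hpos.ne']
  · change (∫ t, f t ∂μ)⁻¹ * f t = 0
    rw [fW ht]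
    simp

/-- The unit ball of `B_p(G)` separates points of `G`, with gap `1`. -/
theorem exists_multiplier_separating [LocallyCompactSpace G] [T2Space G] [μ.IsHaarMeasure]
    [μ.Regular] {p q : ℝ≥0∞} [Fact (1 ≤ p)] [Fact (1 ≤ q)] [hpq : p.HolderConjugate q]
    (hp : p ≠ ∞) (hq : q ≠ ∞) {x y : G} (hxy : x ≠ y) :
    ∃ u : HerzMultiplier p q μ, ‖u‖ ≤ 1 ∧ u.toBCF x = 1 ∧ u.toBCF y = 0 := by
  have hpq' : p.toReal.HolderConjugate q.toReal :=
    ENNReal.HolderConjugate.toReal_of_ne_top hp hq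
  have hp' : 0 < p.toReal⁻¹ := inv_pos.2 hpq'.pos
  have hq' : 0 < q.toReal⁻¹ := inv_pos.2 hpq'.symm.pos
  obtain ⟨U, V, hU, hV, hxU, hyV, hUV⟩ := t2_separation hxy
  -- The neighbourhood is `x⁻¹U ∩ y⁻¹V`: the translate of `h` by `x` vanishes off `U` and the
  -- translate by `y` vanishes off `V`.
  obtain ⟨h, h0, h1, hW⟩ := exists_bump (μ := μ)
    ((hU.preimage (continuous_const_mul x)).inter (hV.preimage (continuous_const_mul y)))
    (by simpa using ⟨hxU, hyV⟩)
  -- Here `u(z) = ∫ h(x⁻¹t)^(1/q) h(z⁻¹t)^(1/p) dt`. At `z = x` the exponents add up to one and the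
  -- integral is `∫ h = 1`; at `z = y` the factors vanish off the disjoint sets `U` and `V`.
  refine ⟨coefficient hp hq (rpowTranslate h hp' 1) (rpowTranslate h hq' x), ?_, ?_, ?_⟩
  · refine (norm_coefficient_le hp hq _ _).trans_eq ?_
    rw [norm_ccLp_rpowTranslate hp h h0 h1, norm_ccLp_rpowTranslate hq h h0 h1, one_mul]
  · rw [coefficient_apply]
    have : ∀ t, rpowTranslate h hq' x t * rpowTranslate h hp' 1 (x⁻¹ * t) =
        ((h (x⁻¹ * t) : ℝ) : ℂ) := fun t => by
      rw [rpowTranslate_apply, rpowTranslate_apply, inv_one, one_mul, ← Complex.ofReal_mul,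
        ← Real.rpow_add_of_nonneg (h0 _) hq'.le hp'.le, hpq'.symm.inv_add_inv_eq_one,
        Real.rpow_one]
    simp only [this]
    rw [integral_complex_ofReal, integral_mul_left_eq_self (fun t => h t), h1, Complex.ofReal_one]
  · rw [coefficient_apply]
    refine integral_eq_zero_of_ae (Eventually.of_forall fun t => ?_)
    simp only [rpowTranslate_apply, inv_one, one_mul, Pi.zero_apply]
    by_cases ht : t ∈ U
    · rw [hW (y⁻¹ * t) fun hm => hUV.notMem_of_mem_left ht (by simpa using hm.2)]
      simp [hp'.ne', Real.zero_rpow]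
    · rw [hW (x⁻¹ * t) fun hm => ht (by simpa using hm.1)]
      simp [hq'.ne', Real.zero_rpow]

end Separation

end Herz

end

/-! ### Conclusion: from separability to discreteness -/

theorem theorem3p4 {G : Type*} [Group G] [TopologicalSpace G] [IsTopologicalGroup G]
    [LocallyCompactSpace G] [T2Space G] [MeasurableSpace G] [BorelSpace G]
    (μ : Measure G) [μ.IsHaarMeasure] [μ.Regular]
    (p q : ℝ≥0∞) [p.HolderConjugate q] (hp : 1 < p) (hp' : p < ∞)
    (hsep : TopologicalSpace.SeparableSpace (StrongDual ℂ (Herz.HerzMultiplier p q μ))) :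
    DiscreteTopology G := by
  -- Density in `L^q` needs `q` finite; `q = ∞` would force `p = 1`.
  have hq : q ≠ ∞ := by
    rintro rfl
    have h := ENNReal.HolderConjugate.inv_add_inv_eq_one p ∞
    rw [ENNReal.inv_top, add_zero, ENNReal.inv_eq_one] at h
    exact hp.ne' h
  have : Fact (1 ≤ p) := ⟨hp.le⟩
  have : Fact (1 ≤ q) := ⟨ENNReal.HolderTriple.le q p 1⟩
  choose δ hδ using fun x : G => Herz.exists_evaluation (p := p) (q := q) (μ := μ) x
  have : Countable G := countable_of_one_le_dist δ fun x y hxy => by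
    obtain ⟨u, hu, hx, hy⟩ :=
      Herz.exists_multiplier_separating (μ := μ) (p := p) (q := q) hp'.ne hq hxy
    -- On this `u` in the unit ball, `δ x - δ y` takes the value one.
    have h := (δ x - δ y).unit_le_opNorm u hu
    rwa [sub_apply, hδ, hδ, hx, hy, sub_zero, norm_one, ← dist_eq_norm] at h
  exact discreteTopology_of_countable_group
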